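/- Let $R_\mu$ and $R_\nu$ be irreducible (finite-dimensional, continuous, unitary) representations of $SU(d)$ on complex Hilbert spaces, and let $R_\lambda\subset R_\mu\otimes R_\nu$ be an irreducible subrepresentation of their tensor product. Weights are vectors $w\in\mathbb{Z}^d$ taken modulo $(1,\dots,1)$; $v$ is a weight vector of weight $w$ if $hv=\prod_i h_i^{w_i}\,v$ for every diagonal $h=\mathrm{diag}(h_1,\dots,h_d)\in SU(d)$. Let $\alpha_i=(0,\dots,0,1,-1,0,\dots,0)$, with the $1$ in position $i$ ($1\le i\le d-1$), be the simple roots, and order weights by $w\preceq w'$ if, modulo $(1,\dots,1)$, $w'-w$ is a combination of the $\alpha_i$ with nonnegative coefficients. Let $\lambda$ and $\nu$ be the highest weights of $R_\lambda$ and $R_\nu$, and let $\mu_*$ be the lowest weight of $R_\mu$. For $x\in\mathbb{R}^d$ put $ht^{\uparrow}_\mu(x)=\max_i|m_i|$, where $x=\mu_*+\sum_i m_i\alpha_i$ modulo $(1,\dots,1)$ (and $ht^\uparrow_\mu(x)=0$ if there are no simple roots). Set $r=ht^{\uparrow}_\mu(\lambda-\nu)$, and let $R_\mu^{\mathcal{W}^{\uparrow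 r}}\subset R_\mu$ be the subspace spanned by the weight vectors whose weight $w$ satisfies $ht^{\uparrow}_\mu(w)\le r$. Then for every unit vector $|\Psi\rangle\in R_\lambda$, the partial trace $\mathrm{tr}_{R_\nu}|\Psi\rangle\langle\Psi|$ is a convex combination of pure $\mathcal{W}^r$-states on $R_\mu$; that is, there are a probability measure $m$ on $SU(d)$ and unit vectors $|\chi_{(g)}\rangle=g|\varphi_{(g)}\rangle$, for every $g\in SU(d)$, with $|\varphi_{(g)}\rangle\in R_\mu^{\mathcal{W}^{\uparrow r}}$, such that $g\mapsto|\chi_{(g)}\rangle\langle\chi_{(g)}|$ is $m$-integrable and $$\mathrm{tr}_{R_\nu}|\Psi\rangle\langle\Psi|=\int_{SU(d)}|\chi_{(g)}\rangle\langle\chi_{(g)}|\,dm(g).$$ -/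

import Mathlib

open MeasureTheory
open scoped TensorProduct

namespace SUdeFinetti

noncomputable section

/-! ### The group `SU(d)` -/

/-- The group `SU(d)`, with the topology it inherits from the matrices. -/
abbrev SU (d : ℕ) : Type := Matrix.specialUnitaryGroup (Fin d) ℂ

/-- `SU(d)` carries its Borel σ-algebra. -/
instance instMeasurableSpaceSU (d : ℕ) : MeasurableSpace (SU d) := borel (SU d)

instance instBorelSpaceSU (d : ℕ) : BorelSpace (SU d) := ⟨rfl⟩

/-- A representation of `SU(d)` on an inner product space is a (continuous) unitary representation:
every group element preserves the inner product, and the action is strongly continuous. -/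
structure IsUnitaryRep {d : ℕ} {V : Type*} [NormedAddCommGroup V] [InnerProductSpace ℂ V]
    (ρ : Representation ℂ (SU d) V) : Prop where
  inner_map : ∀ (g : SU d) (v v' : V), inner ℂ (ρ g v) (ρ g v') = inner ℂ v v'
  continuous_apply : ∀ v : V, Continuous fun g : SU d => ρ g v

/-! ### Simple roots and heights

Integer vectors describing weights of `SU(d)`, and more generally vectors in `ℝᵈ`, matter only
modulo multiples of `(1, …, 1)`. -/

/-- The simple root `αᵢ = (0, …, 0, 1, -1, 0, …, 0)`, with the entry `1` at position `i`
(positions are counted from `0`, so `i = 0, …, d - 2`). -/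
def simpleRoot {d : ℕ} (i : Fin (d - 1)) : Fin d → ℝ := fun k =>
  if (k : ℕ) = i then 1 else if (k : ℕ) = i + 1 then -1 else 0

/-- The coefficients `nᵢ` of the unique expansion `x = ∑ᵢ nᵢ αᵢ` modulo `(1, …, 1)`;
see `eq_rootCoeff_iff`. -/
def rootCoeff {d : ℕ} (x : Fin d → ℝ) (i : Fin (d - 1)) : ℝ :=
  (∑ k : Fin d, if (k : ℕ) ≤ i then x k else 0) - ((i : ℝ) + 1) / d * ∑ k : Fin d, x k

theorem sum_simpleRoot {d : ℕ} (i j : Fin (d - 1)) :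
    (∑ k : Fin d, if (k : ℕ) ≤ i then simpleRoot j k else 0) = if j = i then 1 else 0 := by
  have hj := j.2
  have h : ∀ k : Fin d, (if (k : ℕ) ≤ i then simpleRoot j k else 0) =
      (if k = ⟨j, by omega⟩ then (if (j : ℕ) ≤ i then 1 else 0) else 0) -
      (if k = ⟨j + 1, by omega⟩ then (if (j : ℕ) + 1 ≤ i then 1 else 0) else 0) := by
    intro k
    simp only [simpleRoot, Fin.ext_iff]
    split_ifs <;> first | omega | norm_num
  rw [Finset.sum_congr rfl fun k _ => h k, Finset.sum_sub_distrib]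
  simp only [Finset.sum_ite_eq', Finset.mem_univ, if_true]
  simp only [Fin.ext_iff]
  split_ifs <;> first | omega | norm_num

theorem sum_univ_simpleRoot {d : ℕ} (j : Fin (d - 1)) : ∑ k : Fin d, simpleRoot j k = 0 := by
  have hj := j.2
  have h : ∀ k : Fin d, simpleRoot j k =
      (if k = ⟨j, by omega⟩ then 1 else 0) - (if k = ⟨j + 1, by omega⟩ then 1 else 0) := by
    intro k
    simp only [simpleRoot, Fin.ext_iff]
    split_ifs <;> first | omega | norm_num
  rw [Finset.sum_congr rfl fun k _ => h k, Finset.sum_sub_distrib]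
  simp

theorem eq_rootCoeff_iff {d : ℕ} (x : Fin d → ℝ) (n : Fin (d - 1) → ℝ) :
    n = rootCoeff x ↔ ∃ c : ℝ, ∀ k : Fin d, x k = ∑ i, n i * simpleRoot i k + c := by
  constructor
  · rintro rfl
    set N : ℕ → ℝ := fun j =>
      (∑ k : Fin d, if (k : ℕ) < j then x k else 0) - (j : ℝ) / d * ∑ k : Fin d, x k with hN
    refine ⟨(∑ k : Fin d, x k) / d, fun k => ?_⟩
    have hd : (d : ℝ) ≠ 0 := by
      have := k.2
      exact_mod_cast (by omega : d ≠ 0)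
    have h0 : N 0 = 0 := by simp [hN]
    have hNd : N d = 0 := by simp [hN, hd]
    have hstep : N (k + 1) - N k = x k - (∑ k : Fin d, x k) / d := by
      have : (∑ l : Fin d, if (l : ℕ) < k + 1 then x l else 0) =
          (∑ l : Fin d, if (l : ℕ) < k then x l else 0) + x k := by
        rw [← sub_eq_iff_eq_add', ← Finset.sum_sub_distrib, Finset.sum_eq_single k]
        · simp
        · intro l _ hl
          have hl' : (l : ℕ) ≠ k := fun h => hl (Fin.ext h)
          split_ifs <;> first | omega | simp
        · simp
      simp only [hN, this]
      push_cast
      ring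
    have hc : ∀ i : Fin (d - 1), rootCoeff x i * simpleRoot i k =
        (if (i : ℕ) = k then N (i + 1) else 0) - (if (i : ℕ) + 1 = k then N (i + 1) else 0) := by
      intro i
      have : rootCoeff x i = N (i + 1) := by
        simp only [rootCoeff, hN, Nat.lt_succ_iff]
        push_cast
        rfl
      rw [this]
      simp only [simpleRoot]
      split_ifs <;> first | omega | ring
    rw [Finset.sum_congr rfl fun i _ => hc i, Finset.sum_sub_distrib,
      Fin.sum_univ_eq_sum_range (fun i => if i = (k : ℕ) then N (i + 1) else 0) (d - 1),
      Fin.sum_univ_eq_sum_range (fun i => if i + 1 = (k : ℕ) then N (i + 1) else 0) (d - 1)]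
    have hk := k.2
    have e1 : (∑ i ∈ Finset.range (d - 1), if i = (k : ℕ) then N (i + 1) else 0) = N (k + 1) := by
      rw [Finset.sum_ite_eq']
      split_ifs with h
      · rfl
      · have : (k : ℕ) + 1 = d := by
          simp only [Finset.mem_range] at h
          omega
        rw [this, hNd]
    have e2 : (∑ i ∈ Finset.range (d - 1), if i + 1 = (k : ℕ) then N (i + 1) else 0) = N k := by
      rcases Nat.eq_zero_or_pos (k : ℕ) with h | h
      · rw [h, h0]
        exact Finset.sum_eq_zero fun i _ => by simp
      · rw [Finset.sum_eq_single ((k : ℕ) - 1)]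
        · rw [if_pos (by omega), Nat.sub_add_cancel h]
        · intro i _ hi
          rw [if_neg (by omega)]
        · intro h'
          simp only [Finset.mem_range] at h'
          omega
    rw [e1, e2, hstep]
    ring
  · rintro ⟨c, hx⟩
    funext i
    have hi := i.2
    have hd : (d : ℝ) ≠ 0 := by exact_mod_cast (by omega : d ≠ 0)
    have hS : ∑ k : Fin d, x k = d * c := by
      simp only [hx, Finset.sum_add_distrib]
      rw [Finset.sum_comm]
      simp [← Finset.mul_sum, sum_univ_simpleRoot]
    have hP : (∑ k : Fin d, if (k : ℕ) ≤ i then x k else 0) = n i + ((i : ℝ) + 1) * c := by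
      have : ∀ k : Fin d, (if (k : ℕ) ≤ i then x k else 0) =
          ∑ j, n j * (if (k : ℕ) ≤ i then simpleRoot j k else 0) +
            (if (k : ℕ) ≤ i then c else 0) := by
        intro k
        rw [hx k]
        split_ifs <;> simp
      rw [Finset.sum_congr rfl fun k _ => this k, Finset.sum_add_distrib, Finset.sum_comm]
      simp only [← Finset.mul_sum, sum_simpleRoot]
      have hcount : (∑ k : Fin d, if (k : ℕ) ≤ i then c else 0) = ((i : ℝ) + 1) * c := by
        rw [Fin.sum_univ_eq_sum_range (fun k => if k ≤ (i : ℕ) then c else 0) d,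
          ← Finset.sum_filter]
        have : (Finset.range d).filter (fun k => k ≤ (i : ℕ)) = Finset.range (i + 1) := by
          ext k
          simp only [Finset.mem_filter, Finset.mem_range]
          omega
        rw [this]
        simp
      rw [hcount]
      simp
    rw [rootCoeff, hS, hP]
    field_simp
    ring

/-- The real vector underlying an integer vector. -/
def toReal {d : ℕ} (w : Fin d → ℤ) : Fin d → ℝ := fun k => (w k : ℝ)

/-- The partial order `w ≼ w'` on weights: `w' - w` is, modulo `(1, …, 1)`, a combination of the
simple roots with nonnegative coefficients. -/
def WeightLE {d : ℕ} (w w' : Fin d → ℤ) : Prop :=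
  ∀ i, 0 ≤ rootCoeff (toReal w' - toReal w) i

/-- The height `max_i |mᵢ|` of `x` above `low`, where `x = low + ∑ᵢ mᵢ αᵢ` modulo `(1, …, 1)`.
With `low` the lowest weight of an irreducible representation this is the height of `x` in that
representation, counted from the lowest weight. (It is `0` if there are no simple roots.) -/
def heightAbove {d : ℕ} (low : Fin d → ℤ) (x : Fin d → ℝ) : ℝ :=
  ⨆ i, |rootCoeff (x - toReal low) i|

/-! ### Weights of representations -/

section Weights

variable {d : ℕ} {V : Type*} [AddCommGroup V] [Module ℂ V]

/-- The space of weight vectors of weight `w`: every diagonal `h ∈ SU(d)` acts on it as the scalar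
`∏ᵢ hᵢ ^ wᵢ`. -/
def weightSpace (ρ : Representation ℂ (SU d) V) (w : Fin d → ℤ) : Submodule ℂ V where
  carrier := {v | ∀ h : SU d, (h : Matrix (Fin d) (Fin d) ℂ).IsDiag →
    ρ h v = (∏ i, (h : Matrix (Fin d) (Fin d) ℂ) i i ^ w i) • v}
  add_mem' := by
    intro a b ha hb h hh
    rw [map_add, ha h hh, hb h hh, smul_add]
  zero_mem' := by
    intro h _
    simp
  smul_mem' := by
    intro c v hv h hh
    rw [map_smul, hv h hh, smul_comm]

/-- `w` is a weight of the representation `ρ`: it has a nonzero weight vector. -/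
def IsWeight (ρ : Representation ℂ (SU d) V) (w : Fin d → ℤ) : Prop :=
  ∃ v ∈ weightSpace ρ w, v ≠ 0

/-- `w` is the highest weight of `ρ` (it is determined modulo `(1, …, 1)`). -/
def IsHighestWeight (ρ : Representation ℂ (SU d) V) (w : Fin d → ℤ) : Prop :=
  IsWeight ρ w ∧ ∀ w', IsWeight ρ w' → WeightLE w' w

/-- `w` is the lowest weight of `ρ` (it is determined modulo `(1, …, 1)`). -/
def IsLowestWeight (ρ : Representation ℂ (SU d) V) (w : Fin d → ℤ) : Prop :=
  IsWeight ρ w ∧ ∀ w', IsWeight ρ w' → WeightLE w w'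

/-- The set of weights of `ρ` of height at most `r` above the lowest weight `low`. -/
def lowWeights (ρ : Representation ℂ (SU d) V) (low : Fin d → ℤ) (r : ℝ) : Set (Fin d → ℤ) :=
  {w | IsWeight ρ w ∧ heightAbove low (toReal w) ≤ r}

/-- The subspace generated by the weight vectors whose weight lies in `S`. -/
def weightSubspace (ρ : Representation ℂ (SU d) V) (S : Set (Fin d → ℤ)) : Submodule ℂ V :=
  ⨆ w ∈ S, weightSpace ρ w

end Weights

/-- A `𝒲ʳ`-state of `ρ`: a unit vector of the form `g φ` with `g ∈ SU(d)` and `φ` supported on the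
weights of height at most `r` above the lowest weight `low`. The group element is recorded. -/
def IsWStateAt {d : ℕ} {V : Type*} [NormedAddCommGroup V] [InnerProductSpace ℂ V]
    (ρ : Representation ℂ (SU d) V) (low : Fin d → ℤ) (r : ℝ) (g : SU d) (χ : V) : Prop :=
  ‖χ‖ = 1 ∧ ∃ φ ∈ weightSubspace ρ (lowWeights ρ low r), χ = ρ g φ

/-! ### Pure states and the partial trace -/

/-- The operator `|v⟩⟨v|`. -/
def proj {V : Type*} [NormedAddCommGroup V] [InnerProductSpace ℂ V] (v : V) : V →L[ℂ] V :=
  InnerProductSpace.rankOne ℂ v v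

section PartialTrace

variable {V W : Type*} [NormedAddCommGroup V] [InnerProductSpace ℂ V] [FiniteDimensional ℂ V]
  [NormedAddCommGroup W] [InnerProductSpace ℂ W] [FiniteDimensional ℂ W]

/-- The partial trace over the second tensor factor, as the map
`End (V ⊗ W) ≃ End V ⊗ End W → End V`, `A ⊗ B ↦ tr(B) A`. -/
def partialTrace (T : V ⊗[ℂ] W →L[ℂ] V ⊗[ℂ] W) : V →L[ℂ] V :=
  LinearMap.toContinuousLinearMap
    (TensorProduct.rid ℂ (V →ₗ[ℂ] V)
      (LinearMap.lTensor (V →ₗ[ℂ] V) (LinearMap.trace ℂ W)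
        ((homTensorHomEquiv ℂ V W V W).symm T.toLinearMap)))

theorem partialTrace_map (A : V →ₗ[ℂ] V) (B : W →ₗ[ℂ] W) :
    partialTrace (LinearMap.toContinuousLinearMap (TensorProduct.map A B)) =
      LinearMap.toContinuousLinearMap (LinearMap.trace ℂ W B • A) := by
  have h : TensorProduct.map A B = homTensorHomEquiv ℂ V W V W (A ⊗ₜ B) := by
    rw [homTensorHomEquiv_apply, TensorProduct.homTensorHomMap_apply]
  unfold partialTrace
  congr 1
  rw [LinearMap.coe_toContinuousLinearMap, h, LinearEquiv.symm_apply_apply]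
  simp

end PartialTrace

end

end SUdeFinetti

open SUdeFinetti

namespace SUdeFinetti

noncomputable section

/-! ### Compactness of `SU(d)` and its Haar measure -/

/-! Fix a unit vector ω of weight ν in W. By Schur's lemma the Haar average of |gω⟩⟨gω| is the
identity divided by dim W, so tracing out W amounts to dim W times the average of the matrix
elements against gω (`trace_eq_integral_orbit`, `inner_partialTrace`). For a pure state each term is
again rank one: `partialTrace_proj` gives the Haar integral of |ψ_g⟩⟨ψ_g| with ψ_g = √(dim W) (id ⊗
⟨gω|)Ψ.

By equivariance (`contract_orbit`), ψ_g = √(dim W) g (id ⊗ ⟨ω|) g⁻¹Ψ, and g⁻¹Ψ stays in the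
subrepresentation C. Contraction with ω shifts weights by -ν, so a vector of weight κ ≼ λ in C goes
either to zero or to a vector whose weight κ - ν lies between the lowest weight of V and λ - ν.
Heights are monotone there, hence at most r (`contract_mem_lowWeights`). This uses that C is spanned
by weight vectors (`iSup_weightSpace`), which combines simultaneous diagonalisation of the torus
with integrality of its characters.

The ψ_g need not be unit vectors. Normalising them turns ‖ψ_g‖² into a density against Haar measure,
of total mass tr |Ψ⟩⟨Ψ| = 1. -/

instance (d : ℕ) : IsTopologicalGroup (SU d) where
  continuous_inv := by
    refine Continuous.subtype_mk ?_ _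
    exact continuous_subtype_val.star

instance (d : ℕ) : CompactSpace (SU d) := by
  refine isCompact_iff_compactSpace.mp ?_
  have hcl : IsClosed (Matrix.specialUnitaryGroup (Fin d) ℂ : Set (Matrix (Fin d) (Fin d) ℂ)) := by
    have : (Matrix.specialUnitaryGroup (Fin d) ℂ : Set (Matrix (Fin d) (Fin d) ℂ)) =
        {A | A * star A = 1} ∩ {A | A.det = 1} := by
      ext A
      exact Matrix.mem_specialUnitaryGroup_iff.trans
        (and_congr_left' Matrix.mem_unitaryGroup_iff)
    rw [this]
    exact (isClosed_eq (by fun_prop) continuous_const).inter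
      (isClosed_eq (by fun_prop) continuous_const)
  have hK : IsCompact (Set.univ.pi fun _ : Fin d => Set.univ.pi fun _ : Fin d =>
      Metric.closedBall (0 : ℂ) 1) :=
    isCompact_univ_pi fun _ => isCompact_univ_pi fun _ => isCompact_closedBall 0 1
  refine hK.of_isClosed_subset hcl fun A hA i _ j _ => ?_
  rw [mem_closedBall_zero_iff]
  exact entry_norm_bound_of_unitary (Matrix.specialUnitaryGroup_le_unitaryGroup hA) i j

/-- The normalised Haar measure of `SU(d)`. -/
def haarSU (d : ℕ) : Measure (SU d) := Measure.haarMeasure ⊤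

instance (d : ℕ) : (haarSU d).IsMulLeftInvariant := by
  unfold haarSU; infer_instance

instance (d : ℕ) : IsProbabilityMeasure (haarSU d) :=
  ⟨by simpa [haarSU] using
    Measure.haarMeasure_self (K₀ := (⊤ : TopologicalSpace.PositiveCompacts (SU d)))⟩

theorem integrable_haarSU {d : ℕ} {E : Type*} [NormedAddCommGroup E] {f : SU d → E}
    (hf : Continuous f) : Integrable f (haarSU d) :=
  hf.integrable_of_hasCompactSupport (HasCompactSupport.of_compactSpace f)

/-! ### Averaging over an orbit -/

section Average

variable {d : ℕ} {W : Type*} [NormedAddCommGroup W] [InnerProductSpace ℂ W]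
  {ρ : Representation ℂ (SU d) W}

theorem IsUnitaryRep.norm_map (hρ : IsUnitaryRep ρ) (g : SU d) (v : W) : ‖ρ g v‖ = ‖v‖ := by
  rw [@norm_eq_sqrt_re_inner ℂ, @norm_eq_sqrt_re_inner ℂ, hρ.inner_map]

theorem IsUnitaryRep.continuous_inner_smul (hρ : IsUnitaryRep ρ) (w v : W) :
    Continuous fun g => inner ℂ (ρ g w) v • ρ g w :=
  ((hρ.continuous_apply w).inner continuous_const).smul (hρ.continuous_apply w)

/-- The operator `∫ |g w⟩⟨g w| dg`. -/
def orbitAverage (hρ : IsUnitaryRep ρ) (w : W) : W →ₗ[ℂ] W where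
  toFun v := ∫ g, inner ℂ (ρ g w) v • ρ g w ∂haarSU d
  map_add' x y := by
    simp only [inner_add_right, add_smul]
    exact integral_add (integrable_haarSU (hρ.continuous_inner_smul w x))
      (integrable_haarSU (hρ.continuous_inner_smul w y))
  map_smul' c x := by
    simp only [inner_smul_right, mul_smul, RingHom.id_apply]
    exact integral_smul c _

variable [FiniteDimensional ℂ W]

/-- Substitute g ↦ hg in the average: Haar measure is left invariant, and unitarity cancels h inside
the inner product. -/
theorem orbitAverage_commute (hρ : IsUnitaryRep ρ) (w : W) (h : SU d) (v : W) :
    orbitAverage hρ w (ρ h v) = ρ h (orbitAverage hρ w v) := by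
  have := (LinearMap.toContinuousLinearMap (ρ h)).integral_comp_comm
    (integrable_haarSU (hρ.continuous_inner_smul w v))
  simp only [LinearMap.coe_toContinuousLinearMap', map_smul] at this
  change ∫ g, inner ℂ (ρ g w) (ρ h v) • ρ g w ∂haarSU d =
    ρ h (∫ g, inner ℂ (ρ g w) v • ρ g w ∂haarSU d)
  rw [← this, ← integral_mul_left_eq_self _ h]
  simp [map_mul, hρ.inner_map]

/-- Schur's lemma: an eigenspace of `A` is a nonzero subrepresentation, hence everything. -/
theorem exists_eq_smul_of_commute (hirr : ρ.IsIrreducible) (A : W →ₗ[ℂ] W)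
    (hA : ∀ h v, A (ρ h v) = ρ h (A v)) : ∃ c : ℂ, ∀ v, A v = c • v := by
  by_cases hW : Nontrivial W
  · obtain ⟨c, hc⟩ := Module.End.exists_eigenvalue A
    let S : Subrepresentation ρ := ⟨Module.End.eigenspace A c, fun g v hv => by
      rw [Module.End.mem_eigenspace_iff] at hv ⊢
      rw [hA, hv, map_smul]⟩
    rcases hirr.eq_bot_or_eq_top S with h | h
    · exact absurd (congrArg Subrepresentation.toSubmodule h) hc
    · refine ⟨c, fun v => Module.End.mem_eigenspace_iff.mp ?_⟩
      have : S.toSubmodule = ⊤ := congrArg Subrepresentation.toSubmodule h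
      change v ∈ S.toSubmodule
      rw [this]
      exact Submodule.mem_top
  · rw [not_nontrivial_iff_subsingleton] at hW
    exact ⟨0, fun v => Subsingleton.elim _ _⟩

/-- Expanding the trace in an orthonormal basis, the basis sum collapses under the integral by the
resolution of the identity. -/
theorem integral_inner_orbit (hρ : IsUnitaryRep ρ) (w : W) (B : W →ₗ[ℂ] W) :
    LinearMap.trace ℂ W (B ∘ₗ orbitAverage hρ w) =
      ∫ g, inner ℂ (ρ g w) (B (ρ g w)) ∂haarSU d := by
  have hB : Continuous B := B.continuous_of_finiteDimensional
  let e := stdOrthonormalBasis ℂ W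
  rw [LinearMap.trace_eq_sum_inner _ e]
  have h1 : ∀ i, inner ℂ (e i) ((B ∘ₗ orbitAverage hρ w) (e i)) =
      ∫ g, inner ℂ (ρ g w) (e i) * inner ℂ (e i) (B (ρ g w)) ∂haarSU d := by
    intro i
    have := ((innerSL ℂ (e i)).comp (LinearMap.toContinuousLinearMap B)).integral_comp_comm
      (integrable_haarSU (hρ.continuous_inner_smul w (e i)))
    simp only [ContinuousLinearMap.comp_apply, LinearMap.coe_toContinuousLinearMap', map_smul,
      innerSL_apply_apply, smul_eq_mul] at this
    exact this.symm
  simp only [h1]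
  rw [← integral_finsetSum]
  · simp only [OrthonormalBasis.sum_inner_mul_inner]
  · intro i _
    apply integrable_haarSU
    have := hρ.continuous_apply w
    fun_prop

/-- Orthogonality relation: averaging expectation values over the orbit of a unit vector gives the
normalised trace. -/
theorem trace_eq_integral_orbit (hρ : IsUnitaryRep ρ) (hirr : ρ.IsIrreducible) {w : W}
    (hw : ‖w‖ = 1) (B : W →ₗ[ℂ] W) :
    LinearMap.trace ℂ W B =
      Module.finrank ℂ W * ∫ g, inner ℂ (ρ g w) (B (ρ g w)) ∂haarSU d := by
  obtain ⟨c, hc⟩ := exists_eq_smul_of_commute hirr _ (orbitAverage_commute hρ w)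
  have hA : orbitAverage hρ w = c • LinearMap.id := LinearMap.ext hc
  -- Taking the identity for `B` determines the Schur scalar: `c` times the dimension is 1.
  have h1 := integral_inner_orbit hρ w LinearMap.id
  have h2 := integral_inner_orbit hρ w B
  rw [hA] at h1 h2
  simp only [map_smul, LinearMap.trace_id, LinearMap.id_apply,
    inner_self_eq_norm_sq_to_K, hρ.norm_map, hw, LinearMap.comp_smul, LinearMap.comp_id] at h1 h2
  simp at h1
  rw [← h2, smul_eq_mul, ← mul_assoc, mul_comm _ c, h1, one_mul]

end Average

/-! ### The partial trace as an average -/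

section Contraction

variable {V W : Type*} [NormedAddCommGroup V] [InnerProductSpace ℂ V]
  [NormedAddCommGroup W] [InnerProductSpace ℂ W]

/-- The contraction `(id ⊗ ⟨w|) : V ⊗ W → V`. -/
def contract (w : W) : V ⊗[ℂ] W →ₗ[ℂ] V :=
  TensorProduct.rid ℂ V ∘ₗ LinearMap.lTensor V (innerSL ℂ w).toLinearMap

@[simp]
theorem contract_tmul (w : W) (a : V) (b : W) :
    contract w (a ⊗ₜ[ℂ] b) = (inner ℂ w b : ℂ) • a := by
  simp [contract]

/-- Contraction is the adjoint of x ↦ x ⊗ w. -/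
theorem inner_contract (w : W) (x : V) (t : V ⊗[ℂ] W) :
    inner ℂ x (contract w t) = inner ℂ (x ⊗ₜ[ℂ] w) t := by
  induction t with
  | zero => simp
  | tmul a b => simp [mul_comm]
  | add s t hs ht => rw [map_add, inner_add_right, inner_add_right, hs, ht]

theorem contract_smul_left (c : ℂ) (w : W) (t : V ⊗[ℂ] W) :
    contract (c • w) t = starRingEnd ℂ c • contract w t := by
  induction t with
  | zero => simp
  | tmul a b =>
    rw [contract_tmul, contract_tmul, inner_smul_left, mul_smul]
  | add s t hs ht => rw [map_add, map_add, smul_add, hs, ht]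

variable {d : ℕ} {ρV : Representation ℂ (SU d) V} {ρW : Representation ℂ (SU d) W}

theorem contract_map (hW : IsUnitaryRep ρW) (g : SU d) (w : W) (t : V ⊗[ℂ] W) :
    contract (ρW g w) (ρV.tprod ρW g t) = ρV g (contract w t) := by
  rw [Representation.tprod_apply]
  induction t with
  | zero => simp
  | tmul a b => simp [hW.inner_map]
  | add s t hs ht => simp only [map_add, hs, ht]

/-- The source of the form gφ: the group element moves out of the bra and acts by its inverse on
`t`, which keeps `t` inside any subrepresentation containing it. -/
theorem contract_orbit (hW : IsUnitaryRep ρW) (g : SU d) (w : W) (t : V ⊗[ℂ] W) :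
    contract (ρW g w) t = ρV g (contract w (ρV.tprod ρW g⁻¹ t)) := by
  rw [← contract_map hW, ← Module.End.mul_apply, ← map_mul]
  simp

theorem continuous_contract_orbit (hW : IsUnitaryRep ρW) (w : W) (t : V ⊗[ℂ] W) :
    Continuous fun g => contract (ρW g w) t := by
  induction t with
  | zero => simpa using continuous_const
  | tmul a b =>
    simp only [contract_tmul]
    exact ((hW.continuous_apply w).inner continuous_const).smul continuous_const
  | add s t hs ht => simp only [map_add]; exact hs.add ht

variable [FiniteDimensional ℂ V] [FiniteDimensional ℂ W]

/-- In finite dimension the operators A ⊗ B span End(V ⊗ W), so additive statements can be checked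
on them. -/
theorem partialTrace_induction {p : (V ⊗[ℂ] W →L[ℂ] V ⊗[ℂ] W) → Prop}
    (zero : p 0)
    (map : ∀ (A : V →ₗ[ℂ] V) (B : W →ₗ[ℂ] W),
      p (LinearMap.toContinuousLinearMap (TensorProduct.map A B)))
    (add : ∀ S T, p S → p T → p (S + T)) (T : V ⊗[ℂ] W →L[ℂ] V ⊗[ℂ] W) : p T := by
  obtain ⟨s, hs⟩ := (homTensorHomEquiv ℂ V W V W).surjective T.toLinearMap
  have hT : T = LinearMap.toContinuousLinearMap (homTensorHomEquiv ℂ V W V W s) := by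
    rw [hs]; rfl
  rw [hT]
  clear hs hT
  induction s with
  | zero => simpa using zero
  | tmul A B =>
    rw [homTensorHomEquiv_apply, TensorProduct.homTensorHomMap_apply]
    exact map A B
  | add s t hs ht => simpa only [map_add] using add _ _ hs ht

theorem partialTrace_add (S T : V ⊗[ℂ] W →L[ℂ] V ⊗[ℂ] W) :
    partialTrace (S + T) = partialTrace S + partialTrace T := by
  simp [partialTrace]

theorem partialTrace_zero : partialTrace (0 : V ⊗[ℂ] W →L[ℂ] V ⊗[ℂ] W) = 0 := by
  simp [partialTrace]

theorem trace_partialTrace (T : V ⊗[ℂ] W →L[ℂ] V ⊗[ℂ] W) :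
    LinearMap.trace ℂ V (partialTrace T).toLinearMap =
      LinearMap.trace ℂ (V ⊗[ℂ] W) T.toLinearMap := by
  induction T using partialTrace_induction with
  | zero => simp [partialTrace_zero]
  | map A B =>
    rw [partialTrace_map]
    simp [LinearMap.trace_tensorProduct', mul_comm]
  | add S T hS hT =>
    rw [partialTrace_add, ContinuousLinearMap.toLinearMap_add,
      ContinuousLinearMap.toLinearMap_add, map_add, map_add, hS, hT]

theorem trace_proj (v : V) : LinearMap.trace ℂ V (proj v).toLinearMap = (‖v‖ : ℂ) ^ 2 := by
  rw [LinearMap.trace_eq_sum_inner _ (stdOrthonormalBasis ℂ V)]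
  simp only [proj, ContinuousLinearMap.coe_coe, InnerProductSpace.rankOne_apply, inner_smul_right]
  rw [OrthonormalBasis.sum_inner_mul_inner]
  exact inner_self_eq_norm_sq_to_K v

theorem inner_partialTrace (hW : IsUnitaryRep ρW) (hirr : ρW.IsIrreducible) {w : W}
    (hw : ‖w‖ = 1) (T : V ⊗[ℂ] W →L[ℂ] V ⊗[ℂ] W) (x y : V) :
    inner ℂ x (partialTrace T y) = Module.finrank ℂ W *
      ∫ g, inner ℂ (x ⊗ₜ[ℂ] ρW g w) (T (y ⊗ₜ[ℂ] ρW g w)) ∂haarSU d := by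
  have hcont : Continuous fun g => ρW g w := hW.continuous_apply w
  have htmul : ∀ v : V, Continuous fun g => v ⊗ₜ[ℂ] ρW g w := fun v =>
    TensorProduct.continuous_tmul.comp (continuous_const.prodMk hcont)
  induction T using partialTrace_induction with
  | zero => simp [partialTrace_zero]
  | map A B =>
    rw [partialTrace_map]
    simp only [LinearMap.coe_toContinuousLinearMap', TensorProduct.map_tmul,
      TensorProduct.inner_tmul, integral_const_mul, LinearMap.smul_apply, inner_smul_right,
      trace_eq_integral_orbit hW hirr hw B]
    ring
  | add S T hS hT =>
    rw [partialTrace_add, add_apply, inner_add_right, hS, hT, ← mul_add,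
      ← integral_add]
    · simp only [add_apply, inner_add_right]
    · exact integrable_haarSU ((htmul x).inner (S.continuous.comp (htmul y)))
    · exact integrable_haarSU ((htmul x).inner (T.continuous.comp (htmul y)))

theorem continuous_proj : Continuous (proj : V → V →L[ℂ] V) := by
  refine continuous_clm_apply.mpr fun y => ?_
  simp only [proj, InnerProductSpace.rankOne_apply]
  fun_prop

/-- The partial trace of a pure state is the average of the pure states obtained by contracting with
the orbit of a unit vector. -/
theorem partialTrace_proj (hW : IsUnitaryRep ρW) (hirr : ρW.IsIrreducible) {w : W}
    (hw : ‖w‖ = 1) (t : V ⊗[ℂ] W) :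
    partialTrace (proj t) = ∫ g,
      proj ((Real.sqrt (Module.finrank ℂ W) : ℂ) • contract (ρW g w) t) ∂haarSU d := by
  have hc : Continuous fun g =>
      proj ((Real.sqrt (Module.finrank ℂ W) : ℂ) • contract (V := V) (ρW g w) t) :=
    continuous_proj.comp (continuous_const.smul (continuous_contract_orbit hW w t))
  ext y
  refine ext_inner_left ℂ fun x => ?_
  rw [inner_partialTrace hW hirr hw, ContinuousLinearMap.integral_apply (integrable_haarSU hc),
    ← innerSL_apply_apply ℂ, ← ContinuousLinearMap.integral_comp_comm _
      (integrable_haarSU (hc.clm_apply continuous_const)), ← integral_const_mul]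
  congr 1
  ext g
  -- The factor dim W is shared equally between the ket and the bra.
  have hs : ((Real.sqrt (Module.finrank ℂ W) : ℝ) : ℂ) * (Real.sqrt (Module.finrank ℂ W) : ℝ) =
      Module.finrank ℂ W := by
    rw [← Complex.ofReal_mul, Real.mul_self_sqrt (Nat.cast_nonneg _), Complex.ofReal_natCast]
  have h1 : inner ℂ (contract (ρW g w) t) y = inner ℂ t (y ⊗ₜ[ℂ] ρW g w) := by
    rw [← inner_conj_symm, inner_contract]
    exact inner_conj_symm t _
  simp only [proj, InnerProductSpace.rankOne_apply, innerSL_apply_apply, inner_smul_right,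
    inner_smul_left, Complex.conj_ofReal, inner_contract, h1]
  rw [← hs]
  ring

end Contraction

/-! ### Characters of the circle and of the diagonal torus -/

/-- Some Fourier coefficient is nonzero, since otherwise the Fourier series would give f(0) = 0.
Translating the integral defining it by x multiplies it by e₋ₙ(x) f(x), which must therefore be 1.
-/
theorem exists_int_character {T : ℝ} [Fact (0 < T)] (f : AddCircle T → ℂ) (hf : Continuous f)
    (hadd : ∀ x y, f (x + y) = f x * f y) (h0 : f 0 = 1) :
    ∃ n : ℤ, ∀ x, f x = fourier n x := by
  obtain ⟨n, hn⟩ : ∃ n, fourierCoeff f n ≠ 0 := by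
    by_contra! h
    have hz : fourierCoeff (ContinuousMap.mk f hf) = 0 := funext h
    have hs := has_pointwise_sum_fourier_series_of_summable (f := ContinuousMap.mk f hf)
      (by rw [hz]; exact summable_zero) 0
    have hs0 : HasSum (fun i => fourierCoeff (ContinuousMap.mk f hf) i •
        (fourier i (0 : AddCircle T) : ℂ)) 0 := by
      rw [hz]
      simp
    have h01 : f 0 = 0 := hs.unique hs0
    exact one_ne_zero (h0.symm.trans h01)
  refine ⟨n, fun x => ?_⟩
  have hmul : ∀ y, fourier (-n) (x + y) • f (x + y) =
      (fourier (-n) x * f x) * (fourier (-n) y • f y) := by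
    intro y
    simp only [fourier_apply, smul_add, AddCircle.toCircle_add, Circle.coe_mul,
      hadd, smul_eq_mul]
    ring
  have key : fourierCoeff f n = (fourier (-n) x * f x) * fourierCoeff f n := by
    conv_lhs => rw [fourierCoeff, ← integral_add_left_eq_self _ x]
    simp only [hmul]
    rw [integral_const_mul]
    rfl
  have h1 : fourier (-n) x * f x = 1 := by
    have := mul_right_cancel₀ hn ((one_mul _).trans key)
    exact this.symm
  have h2 : (fourier n x : ℂ) * fourier (-n) x = 1 := by
    rw [← fourier_add]; simp
  calc f x = (fourier n x * fourier (-n) x) * f x := by rw [h2, one_mul]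
    _ = fourier n x := by rw [mul_assoc, h1, mul_one]

theorem exists_zpow_of_circle_hom (f : Circle → ℂ) (hf : Continuous f)
    (hmul : ∀ x y, f (x * y) = f x * f y) (h1 : f 1 = 1) :
    ∃ n : ℤ, ∀ z : Circle, f z = (z : ℂ) ^ n := by
  have : Fact (0 < 2 * Real.pi) := ⟨Real.two_pi_pos⟩
  obtain ⟨n, hn⟩ := exists_int_character (T := 2 * Real.pi) (fun x => f x.toCircle)
    (hf.comp AddCircle.continuous_toCircle)
    (fun x y => by rw [AddCircle.toCircle_add, hmul]) (by rw [AddCircle.toCircle_zero, h1])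
  refine ⟨n, fun z => ?_⟩
  obtain ⟨x, rfl⟩ : ∃ x : AddCircle (2 * Real.pi), x.toCircle = z :=
    (AddCircle.homeomorphCircle Real.two_pi_pos.ne').surjective z |>.imp fun x hx => by
      simpa [AddCircle.homeomorphCircle_apply] using hx
  rw [hn, fourier_apply, AddCircle.toCircle_zsmul, Circle.coe_zpow]

/-- The vector with entry `z` at position `i` and `1` elsewhere. -/
abbrev circleSingle {n : ℕ} (i : Fin (n + 1)) (z : Circle) : Fin (n + 1) → Circle :=
  Pi.mulSingle i z

/-- The diagonal matrix with entry `z` at position `i` and `z⁻¹` at the last position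
(the identity if `i` is the last position). -/
def coordTorus {n : ℕ} (i : Fin (n + 1)) (z : Circle) : SU (n + 1) :=
  ⟨Matrix.diagonal fun k =>
      ((circleSingle i z k * (circleSingle (Fin.last n) z k)⁻¹ : Circle) : ℂ), by
    rw [Matrix.mem_specialUnitaryGroup_iff, Matrix.mem_unitaryGroup_iff]
    constructor
    · rw [Matrix.star_eq_conjTranspose, Matrix.diagonal_conjTranspose, Matrix.diagonal_mul_diagonal,
        ← Matrix.diagonal_one]
      congr 1
      funext k
      simp only [Pi.star_apply, RCLike.star_def, Complex.mul_conj, Circle.normSq_coe,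
        Complex.ofReal_one]
    · rw [Matrix.det_diagonal]
      change ∏ k, Circle.coeHom (circleSingle i z k * (circleSingle (Fin.last n) z k)⁻¹) = 1
      rw [← map_prod]
      simp [Finset.prod_mul_distrib]⟩

theorem coordTorus_isDiag {n : ℕ} (i : Fin (n + 1)) (z : Circle) :
    (coordTorus i z : Matrix (Fin (n + 1)) (Fin (n + 1)) ℂ).IsDiag :=
  Matrix.isDiag_diagonal _

theorem coordTorus_mul {n : ℕ} (i : Fin (n + 1)) (z z' : Circle) :
    coordTorus i (z * z') = coordTorus i z * coordTorus i z' := by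
  apply Subtype.ext
  simp only [coordTorus, Submonoid.coe_mul, Matrix.diagonal_mul_diagonal, Pi.mulSingle_mul]
  congr 1
  funext k
  push_cast
  simp only [Pi.mul_apply, mul_inv, Circle.coe_mul]
  ring

theorem coordTorus_one {n : ℕ} (i : Fin (n + 1)) : coordTorus i 1 = 1 := by
  apply Subtype.ext
  simp [coordTorus]

theorem continuous_coordTorus {n : ℕ} (i : Fin (n + 1)) : Continuous (coordTorus i) := by
  refine Continuous.subtype_mk (Continuous.matrix_diagonal (continuous_pi fun k => ?_)) _
  have h : ∀ j : Fin (n + 1), Continuous fun z : Circle =>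
      circleSingle j z k := fun j =>
    (continuous_apply k).comp (continuous_mulSingle (A := fun _ : Fin (n + 1) => Circle) j)
  exact (continuous_induced_dom : Continuous fun z : Circle => (z : ℂ)).comp ((h i).mul (h _).inv)

theorem norm_diag_entry {d : ℕ} {h : SU d} (hh : (h : Matrix (Fin d) (Fin d) ℂ).IsDiag)
    (i : Fin d) : ‖(h : Matrix (Fin d) (Fin d) ℂ) i i‖ = 1 := by
  have hu := Matrix.mem_unitaryGroup_iff.mp (Matrix.specialUnitaryGroup_le_unitaryGroup h.2)
  rw [← hh.diagonal_diag, Matrix.star_eq_conjTranspose, Matrix.diagonal_conjTranspose,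
    Matrix.diagonal_mul_diagonal] at hu
  have := congrFun (congrFun hu i) i
  simp only [Matrix.diagonal_apply_eq, Matrix.diag_apply, Pi.star_apply, RCLike.star_def,
    Complex.mul_conj, Matrix.one_apply_eq, Complex.normSq_eq_norm_sq] at this
  have h2 : ‖(h : Matrix (Fin d) (Fin d) ℂ) i i‖ ^ 2 = 1 := by exact_mod_cast this
  exact (pow_eq_one_iff_of_nonneg (norm_nonneg _) two_ne_zero).mp h2

theorem prod_diag_entry {d : ℕ} {h : SU d} (hh : (h : Matrix (Fin d) (Fin d) ℂ).IsDiag) :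
    ∏ i, (h : Matrix (Fin d) (Fin d) ℂ) i i = 1 := by
  have hd := (Matrix.mem_specialUnitaryGroup_iff.mp h.2).2
  rw [← hh.diagonal_diag, Matrix.det_diagonal] at hd
  simpa using hd

theorem commute_of_isDiag {d : ℕ} {h k : SU d} (hh : (h : Matrix (Fin d) (Fin d) ℂ).IsDiag)
    (hk : (k : Matrix (Fin d) (Fin d) ℂ).IsDiag) : Commute h k := by
  apply Subtype.ext
  simp only [Submonoid.coe_mul]
  rw [← hh.diagonal_diag, ← hk.diagonal_diag, Matrix.diagonal_mul_diagonal,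
    Matrix.diagonal_mul_diagonal]
  congr 1
  funext i
  exact mul_comm _ _

/-- The inverses accumulating at the last position multiply to 1 because the determinant is 1. This
reduces torus characters to circle characters. -/
theorem eq_prod_coordTorus {n : ℕ} {h : SU (n + 1)}
    (hh : (h : Matrix (Fin (n + 1)) (Fin (n + 1)) ℂ).IsDiag) (z : Fin (n + 1) → Circle)
    (hz : ∀ i, (z i : ℂ) = (h : Matrix (Fin (n + 1)) (Fin (n + 1)) ℂ) i i) :
    h = ((List.finRange (n + 1)).map fun i => coordTorus i (z i)).prod := by
  have hone : ∏ i, z i = 1 := by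
    apply Circle.ext
    change Circle.coeHom _ = 1
    rw [map_prod, ← prod_diag_entry hh]
    exact Finset.prod_congr rfl fun i _ => hz i
  have hprod : ∀ l : List (Fin (n + 1)),
      ((l.map fun i => coordTorus i (z i)).prod : Matrix (Fin (n + 1)) (Fin (n + 1)) ℂ) =
        Matrix.diagonal fun k => (((l.map fun i => circleSingle i (z i) k).prod *
          ((l.map fun i => circleSingle (Fin.last n) (z i) k).prod)⁻¹ : Circle) : ℂ) := by
    intro l
    induction l with
    | nil => simp
    | cons a l ih =>
      simp only [List.map_cons, List.prod_cons, Submonoid.coe_mul, ih]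
      rw [coordTorus, Matrix.diagonal_mul_diagonal]
      congr 1
      funext k
      push_cast
      rw [mul_inv]
      ring
  apply Subtype.ext
  rw [hprod, ← hh.diagonal_diag]
  congr 1
  funext k
  rw [Matrix.diag_apply, ← hz, ← List.ofFn_eq_map, ← List.ofFn_eq_map, List.prod_ofFn,
    List.prod_ofFn]
  congr 1
  have h1 : ∏ i, circleSingle i (z i) k = z k := by
    simp
  have h2 : ∏ i, circleSingle (Fin.last n) (z i) k = 1 := by
    by_cases hk : k = Fin.last n
    · simp [hk, hone]
    · simp [Pi.mulSingle_eq_of_ne hk]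
  rw [h1, h2, inv_one, mul_one]

/-! ### Weight decomposition -/

section Decomposition

variable {d : ℕ} {V : Type*} [NormedAddCommGroup V] [InnerProductSpace ℂ V]
  {ρ : Representation ℂ (SU d) V}

/-- A joint eigenvector of the diagonal torus is a weight vector. -/
theorem exists_mem_weightSpace (hρ : IsUnitaryRep ρ) (χ : SU d → ℂ) {v : V} (hv : v ≠ 0)
    (hχ : ∀ h : SU d, (h : Matrix (Fin d) (Fin d) ℂ).IsDiag → ρ h v = χ h • v) :
    ∃ w, v ∈ weightSpace ρ w := by
  rcases d with _ | n
  · refine ⟨0, fun h _ => ?_⟩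
    have : h = 1 := Subtype.ext (Subsingleton.elim _ _)
    simp [this]
  have hmul : ∀ a b : SU (n + 1), (a : Matrix (Fin (n + 1)) (Fin (n + 1)) ℂ).IsDiag →
      (b : Matrix (Fin (n + 1)) (Fin (n + 1)) ℂ).IsDiag →
      ((a * b : SU (n + 1)) : Matrix (Fin (n + 1)) (Fin (n + 1)) ℂ).IsDiag →
      χ (a * b) = χ a * χ b := by
    intro a b ha hb hab
    have h1 := hχ _ hab
    rw [map_mul, Module.End.mul_apply, hχ b hb, map_smul, hχ a ha, smul_smul, mul_comm] at h1
    exact (smul_left_injective ℂ hv h1).symm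
  -- Writing χ as a matrix coefficient makes it continuous along each coordinate circle.
  have hform : ∀ a : SU (n + 1), (a : Matrix (Fin (n + 1)) (Fin (n + 1)) ℂ).IsDiag →
      χ a = inner ℂ v (ρ a v) / inner ℂ v v := by
    intro a ha
    rw [hχ a ha, inner_smul_right, mul_div_cancel_right₀]
    exact inner_self_ne_zero.mpr hv
  have hchar : ∀ i : Fin (n + 1), ∃ m : ℤ, ∀ z : Circle, χ (coordTorus i z) = (z : ℂ) ^ m := by
    intro i
    refine exists_zpow_of_circle_hom (fun z => χ (coordTorus i z)) ?_ ?_ ?_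
    · have : (fun z => χ (coordTorus i z)) =
          fun z => inner ℂ v (ρ (coordTorus i z) v) / inner ℂ v v :=
        funext fun z => hform _ (coordTorus_isDiag i z)
      rw [this]
      exact (continuous_const.inner
        ((hρ.continuous_apply v).comp (continuous_coordTorus i))).div_const _
    · intro x y
      have hd := coordTorus_isDiag i (x * y)
      rw [coordTorus_mul] at hd
      rw [coordTorus_mul, hmul _ _ (coordTorus_isDiag i x) (coordTorus_isDiag i y) hd]
    · rw [hform _ (coordTorus_isDiag i 1), coordTorus_one, map_one, Module.End.one_apply,
        div_self (inner_self_ne_zero.mpr hv)]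
  -- The last circle maps to the identity, so the last entry of this representative `w` is 0.
  choose w hw using hchar
  refine ⟨w, fun h hh => ?_⟩
  let z : Fin (n + 1) → Circle := fun i =>
    ⟨(h : Matrix (Fin (n + 1)) (Fin (n + 1)) ℂ) i i, mem_sphere_zero_iff_norm.mpr
      (norm_diag_entry hh i)⟩
  have hlist : ∀ l : List (Fin (n + 1)),
      ρ ((l.map fun i => coordTorus i (z i)).prod) v =
        (l.map fun i => (z i : ℂ) ^ w i).prod • v := by
    intro l
    induction l with
    | nil => simp
    | cons a l ih =>
      rw [List.map_cons, List.prod_cons, map_mul, Module.End.mul_apply, ih, map_smul,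
        hχ _ (coordTorus_isDiag _ _), hw, smul_smul, List.map_cons, List.prod_cons, mul_comm]
  conv_lhs => rw [eq_prod_coordTorus hh z fun _ => rfl]
  rw [hlist, ← List.ofFn_eq_map, List.prod_ofFn]

variable [FiniteDimensional ℂ V]

/-- The orthogonal complement of an invariant `p` is invariant: injectivity and dimension give g p =
p, so each vector of `p` is some g u' with u' in `p`. -/
theorem IsUnitaryRep.isSemisimple (hρ : IsUnitaryRep ρ) (g : SU d) :
    Module.End.IsSemisimple (ρ g) := by
  rw [Module.End.isSemisimple_iff]
  intro p hp
  refine ⟨pᗮ, ?_, p.isCompl_orthogonal⟩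
  have hinj : Function.Injective (ρ g) := fun x y hxy => by
    have := hρ.norm_map g (x - y)
    rw [map_sub, hxy, sub_self, norm_zero] at this
    exact sub_eq_zero.mp (norm_eq_zero.mp this.symm)
  have hsurj : ∀ u ∈ p, ∃ u' ∈ p, ρ g u' = u := by
    have hmap : p.map (ρ g) = p := by
      refine Submodule.eq_of_le_of_finrank_eq (Submodule.map_le_iff_le_comap.mpr hp) ?_
      exact (Submodule.equivMapOfInjective (ρ g) hinj p).finrank_eq.symm
    intro u hu
    rw [← hmap] at hu
    exact hu
  intro v hv
  rw [Submodule.mem_comap, Submodule.mem_orthogonal]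
  intro u hu
  obtain ⟨u', hu', rfl⟩ := hsurj u hu
  rw [hρ.inner_map]
  exact (Submodule.mem_orthogonal _ _).mp hv u' hu'

/-- A unitary representation is spanned by its weight vectors. -/
theorem iSup_weightSpace (hρ : IsUnitaryRep ρ) : ⨆ w, weightSpace ρ w = ⊤ := by
  let T := {h : SU d // (h : Matrix (Fin d) (Fin d) ℂ).IsDiag}
  have h := Module.End.iSup_iInf_maxGenEigenspace_eq_top_of_iSup_maxGenEigenspace_eq_top_of_commute
    (fun t : T => (ρ t.1 : Module.End ℂ V))
    (fun s t _ => (commute_of_isDiag s.2 t.2).map ρ)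
    (fun t => Module.End.iSup_maxGenEigenspace_eq_top _)
  rw [eq_top_iff, ← h]
  refine iSup_le fun χ v hv => ?_
  by_cases hv0 : v = 0
  · rw [hv0]; exact Submodule.zero_mem _
  simp only [Submodule.mem_iInf] at hv
  -- Semisimplicity makes the generalised eigenvectors genuine ones. The value 0 off the torus is a
  -- dummy.
  obtain ⟨w, hw⟩ := exists_mem_weightSpace hρ
    (fun h => by classical exact if hh : _ then χ ⟨h, hh⟩ else 0) hv0 (fun h hh => by
      have := hv ⟨h, hh⟩
      rw [(hρ.isSemisimple h).isFinitelySemisimple.maxGenEigenspace_eq_eigenspace,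
        Module.End.mem_eigenspace_iff] at this
      rw [dif_pos hh]
      exact this)
  exact Submodule.mem_iSup_of_mem w hw

end Decomposition

/-! ### Weights of contractions -/

theorem rootCoeff_sub {d : ℕ} (x y : Fin d → ℝ) (i : Fin (d - 1)) :
    rootCoeff (x - y) i = rootCoeff x i - rootCoeff y i := by
  have h : ∀ k : Fin d, (if (k : ℕ) ≤ i then x k - y k else 0) =
      (if (k : ℕ) ≤ i then x k else 0) - (if (k : ℕ) ≤ i then y k else 0) := fun k => by
    split_ifs <;> simp
  simp only [rootCoeff, Pi.sub_apply, h, Finset.sum_sub_distrib]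
  ring

theorem toReal_sub {d : ℕ} (w w' : Fin d → ℤ) : toReal (w - w') = toReal w - toReal w' := by
  funext k
  simp [toReal]

theorem heightAbove_nonneg {d : ℕ} (low : Fin d → ℤ) (x : Fin d → ℝ) : 0 ≤ heightAbove low x :=
  Real.iSup_nonneg fun _ => abs_nonneg _

theorem heightAbove_self {d : ℕ} (low : Fin d → ℤ) : heightAbove low (toReal low) = 0 := by
  simp [heightAbove, rootCoeff]

/-- Heights above `low` are monotone on the weights above `low`. -/
theorem heightAbove_mono {d : ℕ} {low w : Fin d → ℤ} {x : Fin d → ℝ} (h1 : WeightLE low w)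
    (h2 : ∀ i, 0 ≤ rootCoeff (x - toReal w) i) :
    heightAbove low (toReal w) ≤ heightAbove low x := by
  refine ciSup_mono (Set.finite_range _).bddAbove fun i => ?_
  refine abs_le_abs_of_nonneg (h1 i) ?_
  have := h2 i
  simp only [rootCoeff_sub] at this ⊢
  linarith

section Unitary

variable {d : ℕ} {V W : Type*} [NormedAddCommGroup V] [InnerProductSpace ℂ V]
  [NormedAddCommGroup W] [InnerProductSpace ℂ W]
  {ρV : Representation ℂ (SU d) V} {ρW : Representation ℂ (SU d) W}

theorem IsUnitaryRep.tprod (hV : IsUnitaryRep ρV) (hW : IsUnitaryRep ρW) :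
    IsUnitaryRep (ρV.tprod ρW) where
  inner_map g s t := by
    rw [Representation.tprod_apply]
    exact TensorProduct.inner_map_map ((ρV g).isometryOfInner (hV.inner_map g))
      ((ρW g).isometryOfInner (hW.inner_map g)) s t
  continuous_apply t := by
    simp only [Representation.tprod_apply]
    induction t with
    | zero => simpa using continuous_const
    | tmul a b =>
      simp only [TensorProduct.map_tmul]
      exact TensorProduct.continuous_tmul.comp
        ((hV.continuous_apply a).prodMk (hW.continuous_apply b))
    | add s t hs ht => simp only [map_add]; exact hs.add ht

theorem IsUnitaryRep.subrepresentation (hV : IsUnitaryRep ρV) (C : Subrepresentation ρV) :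
    IsUnitaryRep C.toRepresentation where
  inner_map g s t := hV.inner_map g s t
  continuous_apply t := (hV.continuous_apply t).subtype_mk _

/-- The bra contributes the conjugate of ∏ hᵢ^νᵢ, which is its inverse since diagonal entries have
modulus 1. -/
theorem contract_mem_weightSpace (hW : IsUnitaryRep ρW) {w : W} {ν κ : Fin d → ℤ}
    (hw : w ∈ weightSpace ρW ν) {t : V ⊗[ℂ] W} (ht : t ∈ weightSpace (ρV.tprod ρW) κ) :
    contract w t ∈ weightSpace ρV (κ - ν) := by
  intro h hh
  rw [← contract_map hW, hw h hh, ht h hh, map_smul, contract_smul_left, smul_smul, map_prod,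
    ← Finset.prod_mul_distrib]
  congr 1
  refine Finset.prod_congr rfl fun i _ => ?_
  have hn := norm_diag_entry hh i
  have h0 : (h : Matrix (Fin d) (Fin d) ℂ) i i ≠ 0 := norm_ne_zero_iff.mp (by rw [hn]; simp)
  rw [map_zpow₀, ← Complex.inv_eq_conj hn, Pi.sub_apply, zpow_sub₀ h0, inv_zpow, div_eq_mul_inv]

/-- Contracting a vector of a subrepresentation of `V ⊗ W` with a weight vector of weight `ν` only
produces weights of height at most that of `λ - ν`. -/
theorem contract_mem_lowWeights [FiniteDimensional ℂ V] [FiniteDimensional ℂ W]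
    (hV : IsUnitaryRep ρV) (hW : IsUnitaryRep ρW) (C : Subrepresentation (ρV.tprod ρW))
    {low ν lam : Fin d → ℤ} (hlow : ∀ w, IsWeight ρV w → WeightLE low w)
    (hlam : ∀ w, IsWeight C.toRepresentation w → WeightLE w lam)
    {w : W} (hw : w ∈ weightSpace ρW ν) {t : V ⊗[ℂ] W} (ht : t ∈ C) :
    contract w t ∈ weightSubspace ρV
      (lowWeights ρV low (heightAbove low (toReal lam - toReal ν))) := by
  have hmem : (⟨t, ht⟩ : C.toSubmodule) ∈ ⨆ κ, weightSpace C.toRepresentation κ := by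
    rw [iSup_weightSpace ((hV.tprod hW).subrepresentation C)]
    exact Submodule.mem_top
  suffices ∀ s : C.toSubmodule, s ∈ (⨆ κ, weightSpace C.toRepresentation κ) →
      contract w (s : V ⊗[ℂ] W) ∈ weightSubspace ρV
        (lowWeights ρV low (heightAbove low (toReal lam - toReal ν))) from this _ hmem
  intro s hs
  induction hs using Submodule.iSup_induction' with
  | zero => simp
  | add x y _ _ hx hy =>
    rw [Submodule.coe_add, map_add]
    exact Submodule.add_mem _ hx hy
  | mem κ x hx =>
    by_cases h0 : contract w (x : V ⊗[ℂ] W) = 0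
    · rw [h0]; exact Submodule.zero_mem _
    have hκ : IsWeight C.toRepresentation κ := ⟨x, hx, fun h => h0 (by rw [h]; simp)⟩
    have hx' : (x : V ⊗[ℂ] W) ∈ weightSpace (ρV.tprod ρW) κ := fun h hh =>
      congrArg Subtype.val (hx h hh)
    have hc := contract_mem_weightSpace hW hw hx'
    -- The nonzero contraction itself witnesses that κ - ν is a weight of V, so it lies above `low`.
    have hwt : IsWeight ρV (κ - ν) := ⟨_, hc, h0⟩
    refine Submodule.mem_iSup_of_mem (κ - ν) (Submodule.mem_iSup_of_mem ⟨hwt, ?_⟩ hc)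
    refine heightAbove_mono (hlow _ hwt) fun i => ?_
    have := hlam κ hκ i
    simp only [toReal_sub, rootCoeff_sub] at this ⊢
    linarith

end Unitary

/-! ### Normalising a family of vectors -/

section Normalise

variable {d : ℕ} {V : Type*} [NormedAddCommGroup V] [InnerProductSpace ℂ V]

theorem proj_smul (c : ℝ) (v : V) : proj ((c : ℂ) • v) = (c ^ 2) • proj v := by
  ext y
  simp only [proj, InnerProductSpace.rankOne_apply, inner_smul_left, Complex.conj_ofReal,
    smul_apply, smul_smul, ← Complex.coe_smul]
  congr 1
  push_cast
  ring

theorem sq_norm_smul_proj_normalise {v : V} :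
    ‖v‖ ^ 2 • proj (((‖v‖⁻¹ : ℝ) : ℂ) • v) = proj v := by
  by_cases hv : v = 0
  · simp [hv, proj]
  · rw [proj_smul, smul_smul, ← mul_pow, mul_inv_cancel₀ (norm_ne_zero_iff.mpr hv), one_pow,
      one_smul]

end Normalise

end

end SUdeFinetti

/-! ### The convex decomposition from normalised contractions -/

theorem corollary2 (d : ℕ)
    {V W : Type*}
    [NormedAddCommGroup V] [InnerProductSpace ℂ V] [FiniteDimensional ℂ V]
    [NormedAddCommGroup W] [InnerProductSpace ℂ W] [FiniteDimensional ℂ W]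
    (ρV : Representation ℂ (SU d) V) (ρW : Representation ℂ (SU d) W)
    (hV : IsUnitaryRep ρV) (hW : IsUnitaryRep ρW)
    (hVirr : ρV.IsIrreducible) (hWirr : ρW.IsIrreducible)
    (C : Subrepresentation (ρV.tprod ρW))
    (hCirr : C.toRepresentation.IsIrreducible)
    (muLow nu lam : Fin d → ℤ)
    (hmu : IsLowestWeight ρV muLow)
    (hnu : IsHighestWeight ρW nu)
    (hlam : IsHighestWeight C.toRepresentation lam)
    (Ψ : V ⊗[ℂ] W) (hΨC : Ψ ∈ C) (hΨ : ‖Ψ‖ = 1) :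
    ∃ (m : Measure (SU d)) (χ : SU d → V),
      IsProbabilityMeasure m ∧
      (∀ g, IsWStateAt ρV muLow (heightAbove muLow (toReal lam - toReal nu)) g (χ g)) ∧
      Integrable (fun g => proj (χ g)) m ∧
      partialTrace (proj Ψ) = ∫ g, proj (χ g) ∂m := by
  classical
  obtain ⟨⟨ω', hω', hω'0⟩, -⟩ := hnu
  obtain ⟨⟨φ', hφ', hφ'0⟩, hlow⟩ := hmu
  set r := heightAbove muLow (toReal lam - toReal nu) with hr
  set ω : W := ((‖ω'‖⁻¹ : ℝ) : ℂ) • ω' with hω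
  set φ : V := ((‖φ'‖⁻¹ : ℝ) : ℂ) • φ' with hφ
  have hω1 : ‖ω‖ = 1 := by simp [hω, norm_smul, hω'0]
  have hφ1 : ‖φ‖ = 1 := by simp [hφ, norm_smul, hφ'0]
  have hωm : ω ∈ weightSpace ρW nu := Submodule.smul_mem _ _ hω'
  -- The lowest weight has height 0 ≤ r, so φ can serve as a fallback wherever ψ vanishes.
  have hφm : φ ∈ weightSubspace ρV (lowWeights ρV muLow r) := by
    refine Submodule.smul_mem _ _ (Submodule.mem_iSup_of_mem muLow
      (Submodule.mem_iSup_of_mem ⟨⟨φ', hφ', hφ'0⟩, ?_⟩ hφ'))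
    rw [heightAbove_self]
    exact heightAbove_nonneg _ _
  set s : ℂ := ((Real.sqrt (Module.finrank ℂ W) : ℝ) : ℂ) with hs
  set ψ : SU d → V := fun g => s • contract (ρW g ω) Ψ with hψ
  have hψc : Continuous ψ := continuous_const.smul (continuous_contract_orbit hW ω Ψ)
  have hψm : ∀ g, ∃ η ∈ weightSubspace ρV (lowWeights ρV muLow r), ψ g = ρV g η := fun g => by
    refine ⟨s • contract ω (ρV.tprod ρW g⁻¹ Ψ), Submodule.smul_mem _ _ ?_, ?_⟩
    · exact contract_mem_lowWeights hV hW C hlow hlam.2 hωm (C.apply_mem_toSubmodule _ hΨC)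
    · rw [map_smul, ← contract_orbit hW]
  have hproj : Continuous fun g => proj (ψ g) := continuous_proj.comp hψc
  have htr : partialTrace (proj Ψ) = ∫ g, proj (ψ g) ∂haarSU d :=
    partialTrace_proj hW hWirr hω1 Ψ
  -- Take the trace of `htr`; partial trace preserves it.
  have hmass : ∫ g, ‖ψ g‖ ^ 2 ∂haarSU d = 1 := by
    let L : (V →L[ℂ] V) →L[ℂ] ℂ := LinearMap.toContinuousLinearMap
      (LinearMap.trace ℂ V ∘ₗ ContinuousLinearMap.coeLM ℂ)
    have h1 : L (partialTrace (proj Ψ)) = 1 := by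
      change LinearMap.trace ℂ V (partialTrace (proj Ψ)).toLinearMap = 1
      rw [trace_partialTrace, trace_proj, hΨ]
      simp
    rw [htr, ← L.integral_comp_comm (integrable_haarSU hproj)] at h1
    have h2 : ∀ g, L (proj (ψ g)) = ((‖ψ g‖ ^ 2 : ℝ) : ℂ) := fun g => by
      rw [Complex.ofReal_pow]
      exact trace_proj (ψ g)
    simp only [h2] at h1
    rw [integral_complex_ofReal] at h1
    exact_mod_cast h1
  -- A unit vector is required at every g. Where ψ vanishes the density `f` is 0, so the choice
  -- there does not affect the integral.
  let χ : SU d → V := fun g => if ψ g = 0 then ρV g φ else ((‖ψ g‖⁻¹ : ℝ) : ℂ) • ψ g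
  let f : SU d → NNReal := fun g => ‖ψ g‖₊ ^ 2
  have hf : Measurable f := (hψc.nnnorm.pow 2).measurable
  have hχ : ∀ g, f g • proj (χ g) = proj (ψ g) := fun g => by
    change ‖ψ g‖ ^ 2 • proj (χ g) = _
    by_cases h0 : ψ g = 0
    · simp [h0, proj]
    · simp only [χ, if_neg h0]
      exact sq_norm_smul_proj_normalise
  refine ⟨(haarSU d).withDensity fun g => f g, χ, ⟨?_⟩, fun g => ?_, ?_, ?_⟩
  · rw [withDensity_apply _ MeasurableSet.univ, Measure.restrict_univ]
    have h := ofReal_integral_eq_lintegral_ofReal (integrable_haarSU (hψc.norm.pow 2))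
      (Filter.Eventually.of_forall fun g => sq_nonneg ‖ψ g‖)
    simp only [Pi.pow_apply] at h
    rw [hmass, ENNReal.ofReal_one] at h
    rw [h]
    refine lintegral_congr fun g => ?_
    rw [ENNReal.ofReal_pow (norm_nonneg _), ofReal_norm]
    simp [f, enorm_eq_nnnorm]
  · by_cases h0 : ψ g = 0
    · refine ⟨?_, φ, hφm, ?_⟩
      · simp only [χ, if_pos h0, hV.norm_map, hφ1]
      · simp only [χ, if_pos h0]
    · obtain ⟨η, hη, hgη⟩ := hψm g
      refine ⟨?_, ((‖ψ g‖⁻¹ : ℝ) : ℂ) • η, Submodule.smul_mem _ _ hη, ?_⟩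
      · simp [χ, if_neg h0, norm_smul, h0]
      · simp only [χ, if_neg h0, map_smul, ← hgη]
  · rw [integrable_withDensity_iff_integrable_smul hf]
    simp only [hχ]
    exact integrable_haarSU hproj
  · rw [integral_withDensity_eq_integral_smul hf]
    simp only [hχ]
    exact htr
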